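/- Let $\mathbb{H}^2$ be the hyperbolic plane of curvature $-1$, let $\mathbb{H}^2\times\mathbb{R}$ carry the product metric, and let $\partial_z$ be its unit vertical vector field. Let $\mathcal{H}\in C^1([-1,1])$. An $\mathcal{H}$-sphere is an immersed sphere $S$ of class $C^2$ in $\mathbb{H}^2\times\mathbb{R}$ (possibly with self-intersections), oriented by a unit normal field $\eta$, whose mean curvature (half the sum of the principal curvatures with respect to $\eta$) satisfies $H_S(p)=\mathcal{H}(\langle\eta_p,\partial_z\rangle)$ for every $p\in S$. It is rotational if, as an immersed surface, it is carried to itself by the rotations about a vertical axis $\{o\}\times\mathbb{R}$, $o\in\mathbb{H}^2$; that is, it has a parametrization $f:\mathbb{S}^2\to\mathbb{H}^2\times\mathbb{R}$ that intertwines the rotations of $\mathbb{S}^2$ about a diameter with the rotations about this axis. Suppose that there exists a rotational $\mathcal{H}$-sphere in $\mathbb{H}^2\times\mathbb{R}$. Then $$2|\mathcal{H}(y)|>\sqrt{1-y^2}\qquad\text{for every } y\in[-1,1].$$ In particular, $\mathcal{H}$ never vanishes on $[-1,1]$. -/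

import Mathlib

open scoped Manifold ContDiff

noncomputable section

/-- The ambient space `𝕃³ × ℝ`, in which `ℍ² × ℝ` lies. -/
abbrev LR : Type := (Fin 3 → ℝ) × ℝ

/-- The Lorentz product of `𝕃³`, of signature `+,+,-`. -/
def lorentz (v w : Fin 3 → ℝ) : ℝ := v 0 * w 0 + v 1 * w 1 - v 2 * w 2

/-- The product metric `+,+,-,+` of `𝕃³ × ℝ`. Its restriction to `ℍ² × ℝ` is the Riemannian
product metric. -/
def metricLR (v w : LR) : ℝ := lorentz v.1 w.1 + v.2 * w.2

/-- The hyperbolic plane of curvature `-1`, as a quadric in `𝕃³`. -/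
def hypPlane : Set (Fin 3 → ℝ) := {x | lorentz x x = -1 ∧ 0 < x 2}

/-- The unit vertical field `∂_z`. -/
def verticalField : LR := (0, 1)

/-- The round unit sphere: every closed surface of genus zero is diffeomorphic to it. -/
abbrev S2 : Type := Metric.sphere (0 : EuclideanSpace ℝ (Fin 3)) 1

/-- The differential of a map `S² → 𝕃³ × ℝ` at `p`, evaluated at a tangent vector. -/
def diffLR (f : S2 → LR) (p : S2) (u : TangentSpace (𝓡 2) p) : LR :=
  mfderiv (𝓡 2) 𝓘(ℝ, LR) f p u

/-- `f` is an immersion of class `C²` of the sphere into `ℍ² × ℝ`. -/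
structure IsImmersedSphere (f : S2 → LR) : Prop where
  mem : ∀ p, (f p).1 ∈ hypPlane
  contMDiff : ContMDiff (𝓡 2) 𝓘(ℝ, LR) 2 f
  injective : ∀ p, Function.Injective (diffLR f p)

/-- `η` is a unit normal vector field, of class `C¹`, along `f` in `ℍ² × ℝ`: it is tangent to
`ℍ² × ℝ`, orthogonal to the surface and of length one. -/
structure IsUnitNormal (f η : S2 → LR) : Prop where
  contMDiff : ContMDiff (𝓡 2) 𝓘(ℝ, LR) 1 η
  tangent : ∀ p, lorentz (η p).1 (f p).1 = 0
  normal : ∀ p u, metricLR (η p) (diffLR f p u) = 0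
  unit : ∀ p, metricLR (η p) (η p) = 1

/-- The first fundamental form of `f`. -/
def firstForm (f : S2 → LR) (p : S2) (u v : TangentSpace (𝓡 2) p) : ℝ :=
  metricLR (diffLR f p u) (diffLR f p v)

/-- The second fundamental form of `f` with respect to `η`, that is `-⟨∇_u η, df v⟩`. The
Levi-Civita derivative `∇` of `ℍ² × ℝ` is the tangential part of the flat derivative of
`𝕃³ × ℝ`, and `df v` is tangent to `ℍ² × ℝ`, so the flat derivative gives the same value. -/
def secondForm (f η : S2 → LR) (p : S2) (u v : TangentSpace (𝓡 2) p) : ℝ :=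
  -metricLR (diffLR η p u) (diffLR f p v)

/-- `h` is the mean curvature (half the sum of the principal curvatures) at `p` of the immersion
`f` oriented by `η`: the classical formula `(e G - 2 f F + g E) / (2 (E G - F²))`, in any basis of
the tangent plane. -/
def IsMeanCurvatureAt (f η : S2 → LR) (p : S2) (h : ℝ) : Prop :=
  ∀ u v : TangentSpace (𝓡 2) p, LinearIndependent ℝ ![u, v] →
    h = (secondForm f η p u u * firstForm f p v v - 2 * secondForm f η p u v * firstForm f p u v
        + secondForm f η p v v * firstForm f p u u) /
      (2 * (firstForm f p u u * firstForm f p v v - firstForm f p u v ^ 2))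

/-- The angle function `ν = ⟨η, ∂_z⟩`. -/
def angleFunction (η : S2 → LR) (p : S2) : ℝ := metricLR (η p) verticalField

/-- `f`, oriented by `η`, is an immersed sphere in `ℍ² × ℝ` whose mean curvature is the prescribed
function `H` of its angle function. -/
structure IsHSphere (H : ℝ → ℝ) (f η : S2 → LR) : Prop where
  immersed : IsImmersedSphere f
  unitNormal : IsUnitNormal f η
  meanCurvature : ∀ p, IsMeanCurvatureAt f η p (H (angleFunction η p))

/-- The rotation of angle `θ` of the first two coordinates. On `hypPlane` it is the rotation of
`ℍ²` that fixes `(0,0,1)`. -/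
def rot (θ : ℝ) (x : Fin 3 → ℝ) : Fin 3 → ℝ :=
  ![Real.cos θ * x 0 - Real.sin θ * x 1, Real.sin θ * x 0 + Real.cos θ * x 1, x 2]

/-- The rotation of angle `θ` of the unit sphere about its third axis. -/
def rotSphere (θ : ℝ) (p : S2) : S2 :=
  ⟨WithLp.toLp 2 (rot θ (p : EuclideanSpace ℝ (Fin 3)).ofLp), by
    have h := p.2
    rw [mem_sphere_zero_iff_norm, EuclideanSpace.norm_eq, Real.sqrt_eq_one] at h ⊢
    simp only [Fin.sum_univ_three, Real.norm_eq_abs, sq_abs] at h ⊢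
    simp only [rot, Matrix.cons_val_zero, Matrix.cons_val_one, Matrix.cons_val]
    linear_combination h + ((p : EuclideanSpace ℝ (Fin 3)).ofLp 0 ^ 2 +
      (p : EuclideanSpace ℝ (Fin 3)).ofLp 1 ^ 2) * Real.sin_sq_add_cos_sq θ⟩

/-- The linear maps of `𝕃³` that restrict to isometries of `ℍ²`. -/
def IsHypIsometry (A : (Fin 3 → ℝ) ≃ₗ[ℝ] (Fin 3 → ℝ)) : Prop :=
  (∀ v w, lorentz (A v) (A w) = lorentz v w) ∧ ∀ x ∈ hypPlane, A x ∈ hypPlane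

/-- The immersed sphere `f` is rotational about some vertical axis of `ℍ² × ℝ`: for an isometry `A`
of `ℍ²`, the rotations `A ∘ rot θ ∘ A⁻¹` of `ℍ²` that fix the point `A (0,0,1)`, acting as the
identity on the heights, carry the immersion to itself, and correspond on the parameter sphere to
its rotations about an axis. -/
def IsRotational (f : S2 → LR) : Prop :=
  ∃ A : (Fin 3 → ℝ) ≃ₗ[ℝ] (Fin 3 → ℝ), IsHypIsometry A ∧
    ∀ (θ : ℝ) (p : S2), f (rotSphere θ p) = (A (rot θ (A.symm (f p).1)), (f p).2)

end

/-!
The meridian of a rotational `H`-sphere is studied in a phase plane. Let `ρ` be the distance to the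
axis and `φ` the angle of the meridian with the horizontal, so that `cos φ` is the angle function.
In terms of arc length, `ρ' = cos φ` and the mean curvature equation reads
`φ' = 2 H (cos φ) - sin φ coth ρ`; the meridian starts at the axis with `φ = 0`, and it returns to
the axis with `cos φ = -1` (`IsProfile.of_sq_eq_one`).

If `H 1 = 0`, the singular initial value problem has only the horizontal solution. The reason is
the first integral form `(sinh ρ sin φ)' = 2 H (cos φ) (cosh ρ)'`: as `H` is Lipschitz, Gronwall's
argument gives `sin φ = 0`, and the sphere would never turn back
(`IsProfile.apply_one_ne_zero`). Hence `H 1 ≠ 0`, by symmetry `H (-1) ≠ 0`, and a reflection in a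
horizontal plane followed by a change of orientation allows `0 < H 1`. If now
`2 H y₀ ≤ √(1 - y₀²)` for some `y₀ = cos φ₀` with `0 < φ₀ < π`, then
`φ' ≤ sin φ₀ (1 - coth ρ) < 0` whenever `φ = φ₀`, while `φ' = 2 H 1 > 0` whenever `φ = 0`.
So `φ` stays in `(0, φ₀)` and never reaches `π`, a contradiction
(`IsProfile.sqrt_lt_of_mem_Ioo`).

In the hyperboloid model `cosh ρ` is the last coordinate of the point in `𝕃³`, and `-sinh ρ sin φ`
is the last coordinate of the normal. These are differentiable across the poles, so the argument is
run with them and the angle function. The parametrization may map the meridians of `S²` to curves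
that wind about the axis; as the formula for the mean curvature holds in any basis, it is evaluated
on the velocity of such a curve and that of the rotation, and the winding cancels
(`meanCurvature_numerator_eq`).
-/

noncomputable section

/-! ### First zeros and one-sided derivatives -/

theorem exists_first_zero {g : ℝ → ℝ} (hg : Continuous g) {a b : ℝ} (hab : a ≤ b)
    (ha : 0 < g a) (hb : g b ≤ 0) :
    ∃ T, a < T ∧ T ≤ b ∧ g T = 0 ∧ ∀ t, a ≤ t → t < T → 0 < g t := by
  have hc : IsCompact (Set.Icc a b ∩ g ⁻¹' Set.Iic 0) :=
    isCompact_Icc.inter_right (isClosed_Iic.preimage hg)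
  obtain ⟨T, ⟨⟨haT, hTb⟩, hgT⟩, hmin⟩ := hc.exists_isLeast ⟨b, ⟨hab, le_rfl⟩, hb⟩
  have hpos : ∀ t, a ≤ t → t < T → 0 < g t := fun t h1 h2 => by
    by_contra hn
    exact absurd (hmin ⟨⟨h1, h2.le.trans hTb⟩, not_lt.mp hn⟩) (not_le.mpr h2)
  have haT' : a < T := lt_of_le_of_ne haT fun h => by
    subst h; exact absurd hgT (not_le.mpr ha)
  refine ⟨T, haT', hTb, le_antisymm hgT ?_, hpos⟩
  have : Filter.Tendsto g (nhdsWithin T (Set.Iio T)) (nhds (g T)) :=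
    hg.continuousAt.tendsto.mono_left nhdsWithin_le_nhds
  refine ge_of_tendsto this ?_
  filter_upwards [Ico_mem_nhdsLT haT'] with t ht using (hpos t ht.1 ht.2).le

theorem HasDerivAt.nonpos_of_forall_lt_pos {g : ℝ → ℝ} {g' a T : ℝ} (hg : HasDerivAt g g' T)
    (haT : a < T) (h0 : g T ≤ 0) (hpos : ∀ t, a ≤ t → t < T → 0 ≤ g t) : g' ≤ 0 := by
  have := (hasDerivWithinAt_iff_tendsto_slope' (Set.self_notMem_Iio (a := T))).1
    hg.hasDerivWithinAt
  refine le_of_tendsto this ?_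
  filter_upwards [Ico_mem_nhdsLT haT] with t ht
  rw [slope_def_field]
  exact div_nonpos_of_nonneg_of_nonpos (by linarith [hpos t ht.1 ht.2]) (by linarith [ht.2])

/-! ### The phase plane of the profile curve -/

/-- The meridian of a rotational `H`-sphere over the parameter interval `[0, π]`, from pole to
pole, with the orientation that makes the angle function `1` at the first pole. With `ρ` the
distance to the axis and `φ` the angle of the meridian with the horizontal, `C = cosh ρ`,
`W = sinh ρ sin φ`, `k = cos φ` is the angle function, and `μ` is the speed of the profile
curve `(ρ, z)`, with `z` the height, divided by `sinh ρ`. These quantities are used instead of `ρ` and `φ` because they are continuous up to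
the poles and need no choice of an angle; only `μ` blows up there. The three derivatives
amount to `ρ' = μ sinh ρ cos φ` and `φ' = μ sinh ρ (2 H (cos φ) - sin φ coth ρ)`. -/
structure IsProfile (H C W k μ : ℝ → ℝ) : Prop where
  continuous_C : Continuous C
  continuous_W : Continuous W
  continuous_k : Continuous k
  C_zero : C 0 = 1
  C_pi : C Real.pi = 1
  one_lt_C : ∀ t ∈ Set.Ioo 0 Real.pi, 1 < C t
  W_sq : ∀ t ∈ Set.Icc 0 Real.pi, W t ^ 2 = (C t ^ 2 - 1) * (1 - k t ^ 2)
  k_zero : k 0 = 1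
  k_pi : k Real.pi = -1
  μ_pos : ∀ t ∈ Set.Ioo 0 Real.pi, 0 < μ t
  deriv_C : ∀ t ∈ Set.Ioo 0 Real.pi, HasDerivAt C (μ t * k t * (C t ^ 2 - 1)) t
  deriv_W : ∀ t ∈ Set.Ioo 0 Real.pi,
    HasDerivAt W (2 * H (k t) * (μ t * k t * (C t ^ 2 - 1))) t
  deriv_k : ∀ t ∈ Set.Ioo 0 Real.pi,
    HasDerivAt k (-(μ t * W t * (2 * H (k t) - W t * C t / (C t ^ 2 - 1)))) t

namespace IsProfile

variable {H C W k μ : ℝ → ℝ}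

/-- The reflection in a horizontal plane, with the orientation changed so as to keep the angle
function. -/
theorem reflect (h : IsProfile H C W k μ) :
    IsProfile (fun y => -H y) C (fun t => -W t) k μ where
  __ := h
  continuous_W := h.continuous_W.neg
  W_sq t ht := by rw [neg_sq]; exact h.W_sq t ht
  deriv_W t ht := (h.deriv_W t ht).neg.congr_deriv (by ring)
  deriv_k t ht := (h.deriv_k t ht).congr_deriv (by ring)

/-- The reflection in a horizontal plane, with the meridian run backwards; it exchanges the roles of
`H 1` and `H (-1)`. -/
theorem reverse (h : IsProfile H C W k μ) :
    IsProfile (fun y => H (-y)) (fun t => C (Real.pi - t)) (fun t => W (Real.pi - t))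
      (fun t => -k (Real.pi - t)) (fun t => μ (Real.pi - t)) := by
  have hm : ∀ t ∈ Set.Ioo 0 Real.pi, Real.pi - t ∈ Set.Ioo 0 Real.pi := fun t ht =>
    ⟨by linarith [ht.2], by linarith [ht.1]⟩
  have hs : ∀ t, HasDerivAt (fun t => Real.pi - t) (-1) t := fun t => by
    simpa using (hasDerivAt_id t).const_sub Real.pi
  refine ⟨h.continuous_C.comp (by fun_prop), h.continuous_W.comp (by fun_prop),
    (h.continuous_k.comp (by fun_prop)).neg, by simp [h.C_pi], by simp [h.C_zero],
    fun t ht => h.one_lt_C _ (hm t ht), fun t ht => ?_, by simp [h.k_pi], by simp [h.k_zero],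
    fun t ht => h.μ_pos _ (hm t ht), fun t ht => ?_, fun t ht => ?_, fun t ht => ?_⟩
  · rw [neg_sq]
    exact h.W_sq _ ⟨by linarith [ht.2], by linarith [ht.1]⟩
  · exact ((h.deriv_C _ (hm t ht)).comp t (hs t)).congr_deriv (by ring)
  · exact ((h.deriv_W _ (hm t ht)).comp t (hs t)).congr_deriv (by simp only [neg_neg]; ring)
  · exact ((h.deriv_k _ (hm t ht)).comp t (hs t)).neg.congr_deriv (by simp only [neg_neg]; ring)

theorem k_mem (h : IsProfile H C W k μ) {t : ℝ} (ht : t ∈ Set.Ioo 0 Real.pi) :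
    k t ∈ Set.Icc (-1) 1 := by
  have h1 := h.W_sq t (Set.Ioo_subset_Icc_self ht)
  have h2 := h.one_lt_C t ht
  have h3 : 0 ≤ 1 - k t ^ 2 :=
    nonneg_of_mul_nonneg_right (h1 ▸ sq_nonneg (W t)) (by nlinarith)
  exact abs_le.mp (abs_le_one_iff_mul_self_le_one.mpr (by nlinarith))

theorem W_zero (h : IsProfile H C W k μ) : W 0 = 0 := by
  have := h.W_sq 0 ⟨le_rfl, Real.pi_pos.le⟩
  simpa [h.C_zero] using this

/-- If `H 1 = 0`, then horizontal planes are `H`-surfaces, and the meridian would have to stay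
horizontal. This is uniqueness for an equation that is singular at the axis, but in terms of `W`
it is regular: `W' = 2 H(k) C'` and `|H(k)| ≤ K (1 - k)` bound `|W'|` by a multiple of `|W|`, so
`W` vanishes until `k` does, where `W ≠ 0`. -/
theorem apply_one_ne_zero (h : IsProfile H C W k μ) {K : ℝ}
    (hK : ∀ y ∈ Set.Icc (-1 : ℝ) 1, |H y - H 1| ≤ K * (1 - y)) : H 1 ≠ 0 := by
  intro h1
  obtain ⟨T, hT0, hTpi, hkT, hpos⟩ := exists_first_zero h.continuous_k Real.pi_pos.le
    (by simp [h.k_zero]) (by simp [h.k_pi])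
  have hTpi : T < Real.pi := lt_of_le_of_ne hTpi fun e => by
    rw [e, h.k_pi] at hkT; norm_num at hkT
  have hK0 : 0 ≤ K := by
    have := (abs_nonneg _).trans (hK 0 (by norm_num))
    linarith
  have hmem : ∀ t ∈ interior (Set.Icc 0 T), t ∈ Set.Ioo 0 Real.pi := fun t ht => by
    rw [interior_Icc] at ht; exact ⟨ht.1, ht.2.trans hTpi⟩
  -- Gronwall's argument for `W ^ 2`. The weight `√(C - 1)` has derivative at least a multiple of
  -- `C' / √(C ^ 2 - 1)`, so it dominates the distance to the axis and spares the use of `arcosh`.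
  have hcont : ContinuousOn (fun t => W t ^ 2 * Real.exp (-(8 * K * √(C t - 1))))
      (Set.Icc 0 T) := by
    have := h.continuous_C
    have := h.continuous_W
    fun_prop
  have hanti : AntitoneOn (fun t => W t ^ 2 * Real.exp (-(8 * K * √(C t - 1))))
      (Set.Icc 0 T) := by
    refine antitoneOn_of_hasDerivWithinAt_nonpos (convex_Icc 0 T) hcont
      (f' := fun t => (2 * W t * (2 * H (k t) * (μ t * k t * (C t ^ 2 - 1))) -
        W t ^ 2 * (8 * K * (μ t * k t * (C t ^ 2 - 1) / (2 * √(C t - 1))))) *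
        Real.exp (-(8 * K * √(C t - 1)))) (fun t ht => ?_) (fun t ht => ?_)
    · have hm := hmem t ht
      have hC := h.one_lt_C t hm
      have e1 := ((h.deriv_C t hm).sub_const 1).sqrt (by linarith)
      refine ((((h.deriv_W t hm).pow 2).mul
        ((e1.const_mul (8 * K)).neg.exp)).congr_deriv ?_).hasDerivWithinAt
      simp only [Pi.pow_apply, Pi.neg_apply]
      push_cast
      ring
    · have hm := hmem t ht
      rw [interior_Icc] at ht
      have hC := h.one_lt_C t hm
      have hk := hpos t ht.1.le ht.2
      have hk1 := (h.k_mem hm).2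
      have hμ := h.μ_pos t hm
      have hC' : 0 < μ t * k t * (C t ^ 2 - 1) := by
        have : 0 < C t ^ 2 - 1 := by nlinarith
        positivity
      refine mul_nonpos_of_nonpos_of_nonneg ?_ (Real.exp_pos _).le
      set s := √(C t - 1) with hs
      have hs0 : 0 < s := Real.sqrt_pos.mpr (by linarith)
      have hss : s ^ 2 = C t - 1 := Real.sq_sqrt (by linarith)
      have hW := h.W_sq t (Set.Ioo_subset_Icc_self hm)
      have hH := hK (k t) (h.k_mem hm)
      rw [h1, sub_zero] at hH
      have hWs : (1 - k t) * s ≤ |W t| := by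
        refine abs_le_of_sq_le_sq' ?_ (abs_nonneg _) |>.2
        rw [sq_abs, hW, mul_pow, hss]
        have e1 : C t ^ 2 - 1 = (C t - 1) * (C t + 1) := by ring
        have e2 : (1 - k t) ^ 2 ≤ (1 - k t ^ 2) * (C t + 1) := by
          nlinarith [mul_nonneg (sub_nonneg.2 hk1) hk.le,
            mul_nonneg (mul_nonneg (sub_nonneg.2 hk1) (by linarith : 0 ≤ 1 + k t))
              (by linarith : 0 ≤ C t)]
        rw [e1]
        nlinarith [mul_le_mul_of_nonneg_left e2 (by linarith : 0 ≤ C t - 1)]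
      have key : W t * H (k t) ≤ W t ^ 2 * (K / s) := by
        calc W t * H (k t) ≤ |W t| * |H (k t)| := by rw [← abs_mul]; exact le_abs_self _
          _ ≤ |W t| * (K * (|W t| / s)) := by
            gcongr
            refine hH.trans ?_
            gcongr
            rwa [le_div_iff₀ hs0]
          _ = W t ^ 2 * (K / s) := by rw [← sq_abs]; ring
      have e3 : 2 * W t * (2 * H (k t) * (μ t * k t * (C t ^ 2 - 1))) -
        W t ^ 2 * (8 * K * (μ t * k t * (C t ^ 2 - 1) / (2 * s))) =
        4 * (μ t * k t * (C t ^ 2 - 1)) * (W t * H (k t) - W t ^ 2 * (K / s)) := by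
        field_simp
        ring
      rw [e3]
      exact mul_nonpos_of_nonneg_of_nonpos (by positivity) (by linarith)
  have h2 := hanti ⟨le_rfl, hT0.le⟩ ⟨hT0.le, le_rfl⟩ hT0.le
  simp only [h.W_zero] at h2
  have h3 : 0 < W T ^ 2 := by
    rw [h.W_sq T ⟨hT0.le, hTpi.le⟩, hkT]
    have := h.one_lt_C T ⟨hT0, hTpi⟩
    nlinarith
  have := mul_pos h3 (Real.exp_pos (-(8 * K * √(C T - 1))))
  norm_num at h2
  linarith

/-- The barrier argument. If `2 H(y) ≤ √(1 - y²)`, then at a point with `k = y` and `W > 0` the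
angle function increases, because `coth ρ > 1`; so `k`, which starts at `1`, cannot come down to
`y`, although it has to reach `-1` at the other pole. Meanwhile `W` stays positive, since
`H 1 > 0` prevents the meridian from becoming horizontal with `k = 1` again. -/
theorem sqrt_lt_of_mem_Ioo (h : IsProfile H C W k μ) (hH : ContinuousOn H (Set.Icc (-1) 1))
    (h1 : 0 < H 1) {y : ℝ} (hy : y ∈ Set.Ioo (-1 : ℝ) 1) : √(1 - y ^ 2) < 2 * H y := by
  by_contra hn
  rw [not_lt] at hn
  have hy2 : 0 < 1 - y ^ 2 := by nlinarith [hy.1, hy.2]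
  have hpi := Real.pi_pos
  -- `W 0 = 0`, so the barrier can only be set up shortly after the pole.
  obtain ⟨δ, hδ0, hδ1, hδk⟩ : ∃ δ, 0 < δ ∧ δ < Real.pi ∧
      ∀ t, 0 < t → t ≤ δ → y < k t ∧ 0 < k t ∧ 0 < H (k t) := by
    have hk : Filter.Tendsto k (nhdsWithin 0 (Set.Ioo 0 Real.pi))
        (nhdsWithin 1 (Set.Icc (-1) 1)) := by
      refine tendsto_nhdsWithin_iff.mpr ⟨?_, ?_⟩
      · have := h.continuous_k.tendsto 0
        rw [h.k_zero] at this
        exact this.mono_left nhdsWithin_le_nhds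
      · filter_upwards [self_mem_nhdsWithin] with t ht using h.k_mem ht
    have e1 := hk.eventually ((hH 1 (by norm_num)).eventually (lt_mem_nhds h1))
    have e2 := hk.eventually (nhdsWithin_le_nhds (lt_mem_nhds hy.2))
    have e3 := hk.eventually (nhdsWithin_le_nhds (lt_mem_nhds (zero_lt_one (α := ℝ))))
    rw [nhdsWithin_Ioo_eq_nhdsGT hpi] at e1 e2 e3
    obtain ⟨u, hu, hsub⟩ := mem_nhdsGT_iff_exists_Ioc_subset.1
      ((e2.and (e3.and e1)).and (Ioo_mem_nhdsGT hpi))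
    refine ⟨u, hu, (hsub ⟨hu, le_rfl⟩).2.2, fun t h0 h2 => (hsub ⟨h0, h2⟩).1⟩
  have hWδ : 0 < W δ := by
    have hmono : StrictMonoOn W (Set.Icc 0 δ) := by
      refine strictMonoOn_of_deriv_pos (convex_Icc 0 δ) h.continuous_W.continuousOn
        fun t ht => ?_
      rw [interior_Icc] at ht
      have hm : t ∈ Set.Ioo 0 Real.pi := ⟨ht.1, ht.2.trans hδ1⟩
      rw [(h.deriv_W t hm).deriv]
      obtain ⟨-, a, b⟩ := hδk t ht.1 ht.2.le
      have := h.μ_pos t hm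
      have : 0 < C t ^ 2 - 1 := by nlinarith [h.one_lt_C t hm]
      positivity
    simpa [h.W_zero] using hmono ⟨le_rfl, hδ0.le⟩ ⟨hδ0.le, le_rfl⟩ hδ0
  obtain ⟨T, hT0, hTpi, hgT, hpos⟩ := exists_first_zero (g := fun t => min (k t - y) (W t))
    ((h.continuous_k.sub continuous_const).min h.continuous_W) hδ1.le
    (lt_min (by linarith [(hδk δ hδ0 le_rfl).1]) hWδ)
    (min_le_of_left_le (by rw [h.k_pi]; linarith [hy.1]))
  have hTpi : T < Real.pi := lt_of_le_of_ne hTpi fun e => by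
    have : min (k T - y) (W T) ≤ k T - y := min_le_left _ _
    rw [hgT, e, h.k_pi] at this
    linarith [hy.1]
  have hm : T ∈ Set.Ioo 0 Real.pi := ⟨hδ0.trans hT0, hTpi⟩
  have hkT : y ≤ k T := by
    have : min (k T - y) (W T) ≤ k T - y := min_le_left _ _
    linarith
  have hWT : 0 ≤ W T := by
    have : min (k T - y) (W T) ≤ W T := min_le_right _ _
    linarith
  have hμ := h.μ_pos T hm
  have hC := h.one_lt_C T hm
  have hC2 : 0 < C T ^ 2 - 1 := by nlinarith
  have hrel := h.W_sq T (Set.Ioo_subset_Icc_self hm)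
  rcases eq_or_lt_of_le hkT with hky | hky
  · rw [← hky] at hrel
    have hd := h.deriv_k T hm
    have hle := (hd.sub_const y).nonpos_of_forall_lt_pos hT0 (by linarith)
      fun t h1 h2 => (lt_min_iff.mp (hpos t h1 h2)).1.le
    rw [← hky] at hle
    have hWpos : 0 < W T := by
      have : 0 < W T ^ 2 := hrel ▸ mul_pos hC2 hy2
      exact lt_of_le_of_ne hWT fun e => by rw [← e] at this; norm_num at this
    -- This is `sin φ < sin φ coth ρ`.
    have hlt : √(1 - y ^ 2) < W T * C T / (C T ^ 2 - 1) := by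
      rw [Real.sqrt_lt' (by positivity), div_pow, mul_pow, hrel, lt_div_iff₀ (by positivity)]
      nlinarith [mul_pos hC2 hy2]
    have : 0 < μ T * W T * (W T * C T / (C T ^ 2 - 1) - 2 * H y) :=
      mul_pos (mul_pos hμ hWpos) (by linarith)
    nlinarith
  · have hW0 : W T = 0 := by
      rcases min_choice (k T - y) (W T) with e | e
      · rw [hgT] at e; linarith
      · rw [hgT] at e; exact e.symm
    have hk1 : k T = 1 := by
      rw [hW0] at hrel
      have : (1 - k T) * (1 + k T) = 0 := by
        rcases mul_eq_zero.mp (by linarith : (C T ^ 2 - 1) * (1 - k T ^ 2) = 0) with e | e <;>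
          linarith
      rcases mul_eq_zero.mp this with e | e
      · linarith
      · linarith [hy.1]
    have hle := (h.deriv_W T hm).nonpos_of_forall_lt_pos hT0 hW0.le
      fun t h1 h2 => (lt_min_iff.mp (hpos t h1 h2)).2.le
    rw [hk1] at hle
    have : 0 < 2 * H 1 * (μ T * 1 * (C T ^ 2 - 1)) := by positivity
    linarith

theorem sqrt_lt_of_pos (h : IsProfile H C W k μ) {K : NNReal}
    (hK : LipschitzOnWith K H (Set.Icc (-1) 1)) (h1 : 0 < H 1) :
    ∀ y ∈ Set.Icc (-1 : ℝ) 1, √(1 - y ^ 2) < 2 * |H y| := by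
  have hIoo : ∀ y ∈ Set.Ioo (-1 : ℝ) 1, 0 < H y := fun y hy => by
    have := h.sqrt_lt_of_mem_Ioo hK.continuousOn h1 hy
    linarith [Real.sqrt_nonneg (1 - y ^ 2)]
  intro y hy
  rcases eq_or_lt_of_le hy.2 with rfl | hy1
  · simpa using h1.ne'
  rcases eq_or_lt_of_le hy.1 with rfl | hy0
  · have := h.reverse.apply_one_ne_zero (K := K) fun y hy => by
      have := hK.dist_le_mul (-y) ⟨by linarith [hy.2], by linarith [hy.1]⟩ (-1) (by norm_num)
      rw [Real.dist_eq, Real.dist_eq] at this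
      rwa [show -y - -1 = 1 - y by ring, abs_of_nonneg (by linarith [hy.2] : 0 ≤ 1 - y)] at this
    simpa using this
  · rw [abs_of_pos (hIoo y ⟨hy0, hy1⟩)]
    exact h.sqrt_lt_of_mem_Ioo hK.continuousOn h1 ⟨hy0, hy1⟩

theorem sqrt_lt (h : IsProfile H C W k μ) {K : NNReal}
    (hK : LipschitzOnWith K H (Set.Icc (-1) 1)) :
    ∀ y ∈ Set.Icc (-1 : ℝ) 1, √(1 - y ^ 2) < 2 * |H y| := by
  have hne := h.apply_one_ne_zero (K := K) fun y hy => by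
    have := hK.dist_le_mul y hy 1 (by norm_num)
    rwa [Real.dist_eq, Real.dist_eq, abs_sub_comm y, abs_of_nonneg (by linarith [hy.2] : 0 ≤ 1 - y)]
      at this
  rcases lt_or_gt_of_ne hne with h1 | h1
  · simpa using h.reflect.sqrt_lt_of_pos hK.neg (by simpa using h1)
  · exact h.sqrt_lt_of_pos hK h1

end IsProfile

/-! ### The mean curvature equation in coordinates -/

section Algebra

-- `(x₀, x₁, C)` is the horizontal part of a point of the surface and `(n₀, n₁, n₂)`, `k` are the
-- two parts of the normal; the letter `d` marks derivatives along the meridian, `h` is the height.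

variable {x₀ x₁ C dx₀ dx₁ dC dh n₀ n₁ n₂ k dn₀ dn₁ dn₂ dk H : ℝ}

/-- The determinant of the first fundamental form in the basis of the meridian vector and the
vector of the rotation. -/
theorem gram_eq (e1 : x₀ ^ 2 + x₁ ^ 2 = C ^ 2 - 1) (d1 : x₀ * dx₀ + x₁ * dx₁ = C * dC) :
    (dx₀ ^ 2 + dx₁ ^ 2 - dC ^ 2 + dh ^ 2) * (x₀ ^ 2 + x₁ ^ 2) - (x₀ * dx₁ - x₁ * dx₀) ^ 2 =
      dC ^ 2 + dh ^ 2 * (C ^ 2 - 1) := by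
  linear_combination (dh ^ 2 - dC ^ 2) * e1 + (x₀ * dx₀ + x₁ * dx₁ + C * dC) * d1

/-- The normal is orthogonal to the orbits of the rotation, so its horizontal part is radial. -/
theorem normal_mul_coord
    (e1 : x₀ ^ 2 + x₁ ^ 2 = C ^ 2 - 1) (e2 : n₀ * x₀ + n₁ * x₁ = n₂ * C)
    (e3 : n₁ * x₀ = n₀ * x₁) :
    (C ^ 2 - 1) * n₀ = n₂ * C * x₀ ∧ (C ^ 2 - 1) * n₁ = n₂ * C * x₁ :=
  ⟨by linear_combination x₀ * e2 - x₁ * e3 - n₀ * e1,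
    by linear_combination x₁ * e2 + x₀ * e3 - n₁ * e1⟩

/-- The numerator `e G - 2 f F + g E` of the mean curvature. The meridian need not lie in a vertical
plane; the terms with its angular velocity, `x₀ dx₁ - x₁ dx₀`, cancel. -/
theorem meanCurvature_numerator_eq (hD : 0 < C ^ 2 - 1)
    (e1 : x₀ ^ 2 + x₁ ^ 2 = C ^ 2 - 1) (d1 : x₀ * dx₀ + x₁ * dx₁ = C * dC)
    (e2 : n₀ * x₀ + n₁ * x₁ = n₂ * C) (e3 : n₁ * x₀ = n₀ * x₁)
    (d2 : dn₀ * x₀ + n₀ * dx₀ + (dn₁ * x₁ + n₁ * dx₁) = dn₂ * C + n₂ * dC)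
    (d3 : dn₁ * x₀ + n₁ * dx₀ = dn₀ * x₁ + n₀ * dx₁) :
    -(dn₀ * dx₀ + dn₁ * dx₁ - dn₂ * dC + dk * dh) * (x₀ ^ 2 + x₁ ^ 2)
        - 2 * -(x₀ * dn₁ - x₁ * dn₀) * (x₀ * dx₁ - x₁ * dx₀)
        + -(n₀ * x₀ + n₁ * x₁) * (dx₀ ^ 2 + dx₁ ^ 2 - dC ^ 2 + dh ^ 2) =
      -dn₂ * dC - dk * dh * (C ^ 2 - 1) - n₂ * C * dh ^ 2 := by
  obtain ⟨a0, a1⟩ := normal_mul_coord e1 e2 e3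
  have b1 : (C ^ 2 - 1) * (x₀ * dn₀ + x₁ * dn₁) = (C ^ 2 - 1) * dn₂ * C - n₂ * dC := by
    linear_combination (C ^ 2 - 1) * d2 - dx₀ * a0 - dx₁ * a1 - n₂ * C * d1
  have b2 : (C ^ 2 - 1) * (x₀ * dn₁ - x₁ * dn₀) = n₂ * C * (x₀ * dx₁ - x₁ * dx₀) := by
    linear_combination (C ^ 2 - 1) * d3 + dx₁ * a0 - dx₀ * a1
  have b3 : (C ^ 2 - 1) * (dx₀ ^ 2 + dx₁ ^ 2) =
      C ^ 2 * dC ^ 2 + (x₀ * dx₁ - x₁ * dx₀) ^ 2 := by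
    linear_combination (x₀ * dx₀ + x₁ * dx₁ + C * dC) * d1 - (dx₀ ^ 2 + dx₁ ^ 2) * e1
  have b4 : (dn₀ * dx₀ + dn₁ * dx₁) * (x₀ ^ 2 + x₁ ^ 2) =
      (x₀ * dn₀ + x₁ * dn₁) * (C * dC) + (x₀ * dn₁ - x₁ * dn₀) * (x₀ * dx₁ - x₁ * dx₀) := by
    linear_combination (x₀ * dn₀ + x₁ * dn₁) * d1
  refine mul_left_cancel₀ hD.ne' ?_
  linear_combination -(C ^ 2 - 1) * b4 - C * dC * b1 + (x₀ * dx₁ - x₁ * dx₀) * b2 - n₂ * C * b3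
    + (C ^ 2 - 1) * (dn₂ * dC - dk * dh) * e1
    - (C ^ 2 - 1) * (dx₀ ^ 2 + dx₁ ^ 2 - dC ^ 2 + dh ^ 2) * e2

theorem normal_sq
    (e1 : x₀ ^ 2 + x₁ ^ 2 = C ^ 2 - 1) (e2 : n₀ * x₀ + n₁ * x₁ = n₂ * C)
    (e3 : n₁ * x₀ = n₀ * x₁) (e5 : n₀ ^ 2 + n₁ ^ 2 - n₂ ^ 2 + k ^ 2 = 1) :
    n₂ ^ 2 = (C ^ 2 - 1) * (1 - k ^ 2) := by
  obtain ⟨a0, a1⟩ := normal_mul_coord e1 e2 e3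
  linear_combination (C ^ 2 - 1) * e5 - n₀ * a0 - n₁ * a1 - n₂ * C * e2

theorem normal_mul_deriv
    (e1 : x₀ ^ 2 + x₁ ^ 2 = C ^ 2 - 1) (d1 : x₀ * dx₀ + x₁ * dx₁ = C * dC)
    (e2 : n₀ * x₀ + n₁ * x₁ = n₂ * C) (e3 : n₁ * x₀ = n₀ * x₁)
    (e4 : n₀ * dx₀ + n₁ * dx₁ - n₂ * dC + k * dh = 0) :
    -n₂ * dC = k * dh * (C ^ 2 - 1) := by
  obtain ⟨a0, a1⟩ := normal_mul_coord e1 e2 e3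
  linear_combination -(C ^ 2 - 1) * e4 + dx₀ * a0 + dx₁ * a1 + n₂ * C * d1

/-- The unit normal relations and the mean curvature equation, solved for the derivatives. -/
theorem profile_system {W dW : ℝ} (hD : 0 < C ^ 2 - 1)
    (hW : W ^ 2 = (C ^ 2 - 1) * (1 - k ^ 2))
    (hdW : 2 * (W * dW) = 2 * C * dC * (1 - k ^ 2) - (C ^ 2 - 1) * (2 * (k * dk)))
    (hdC : W * dC = k * dh * (C ^ 2 - 1))
    (hne : dC ^ 2 + dh ^ 2 * (C ^ 2 - 1) ≠ 0)
    (hM : 2 * H * (dC ^ 2 + dh ^ 2 * (C ^ 2 - 1)) =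
      dW * dC - dk * dh * (C ^ 2 - 1) + W * C * dh ^ 2) :
    (dC * k + dh * W) / (C ^ 2 - 1) ≠ 0 ∧
    dC = (dC * k + dh * W) / (C ^ 2 - 1) * k * (C ^ 2 - 1) ∧
    dW = 2 * H * ((dC * k + dh * W) / (C ^ 2 - 1) * k * (C ^ 2 - 1)) ∧
    dk = -((dC * k + dh * W) / (C ^ 2 - 1) * W * (2 * H - W * C / (C ^ 2 - 1))) := by
  obtain ⟨μ, hμ⟩ : ∃ μ, μ = (dC * k + dh * W) / (C ^ 2 - 1) := ⟨_, rfl⟩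
  have hD' := hD.ne'
  have hμD : μ * (C ^ 2 - 1) = dC * k + dh * W := by rw [hμ]; field_simp
  rw [← hμ]
  have hC : dC = μ * k * (C ^ 2 - 1) := by
    refine mul_left_cancel₀ hD' ?_
    linear_combination -(C ^ 2 - 1) * k * hμD - dC * hW + W * hdC
  have hh : dh = μ * W := by
    refine mul_left_cancel₀ hD' ?_
    linear_combination -W * hμD - dh * hW - k * hdC
  have hμ0 : μ ≠ 0 := by
    rintro rfl
    apply hne
    rw [hC, hh]; ring
  -- divide the mean curvature equation by `μ (C² - 1)`
  have hM' : 2 * H * μ * (C ^ 2 - 1) ^ 2 =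
      (dW * k - dk * W) * (C ^ 2 - 1) + W ^ 3 * C * μ := by
    refine mul_left_cancel₀ hμ0 ?_
    rw [hC, hh] at hM
    linear_combination hM - 2 * H * μ ^ 2 * (C ^ 2 - 1) * hW
  refine ⟨hμ0, hC, ?_, ?_⟩
  · refine mul_left_cancel₀ hD' ?_
    rw [hC] at hdW
    linear_combination -k * hM' - dW * hW + W / 2 * hdW - C * μ * k * W * hW
  · have e : W * C / (C ^ 2 - 1) * (C ^ 2 - 1) = W * C := div_mul_cancel₀ _ hD'
    refine mul_left_cancel₀ (pow_ne_zero 2 hD') ?_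
    rw [hC] at hdW
    linear_combination W * hM' - dk * (C ^ 2 - 1) * hW + k / 2 * (C ^ 2 - 1) * hdW
      + C * μ * (W ^ 2 - (C ^ 2 - 1) * k ^ 2) * hW - μ * W * (C ^ 2 - 1) * e

theorem profile_system_of_forms (hD : 0 < C ^ 2 - 1)
    (e1 : x₀ ^ 2 + x₁ ^ 2 = C ^ 2 - 1) (d1 : x₀ * dx₀ + x₁ * dx₁ = C * dC)
    (e2 : n₀ * x₀ + n₁ * x₁ = n₂ * C) (e3 : n₁ * x₀ = n₀ * x₁)
    (d2 : dn₀ * x₀ + n₀ * dx₀ + (dn₁ * x₁ + n₁ * dx₁) = dn₂ * C + n₂ * dC)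
    (d3 : dn₁ * x₀ + n₁ * dx₀ = dn₀ * x₁ + n₀ * dx₁)
    (e4 : n₀ * dx₀ + n₁ * dx₁ - n₂ * dC + k * dh = 0)
    (e5 : n₀ ^ 2 + n₁ ^ 2 - n₂ ^ 2 + k ^ 2 = 1)
    (d6 : 2 * (n₂ * dn₂) = 2 * C * dC * (1 - k ^ 2) - (C ^ 2 - 1) * (2 * (k * dk)))
    (hne : dC ^ 2 + dh ^ 2 * (C ^ 2 - 1) ≠ 0)
    (hH : H = (-(dn₀ * dx₀ + dn₁ * dx₁ - dn₂ * dC + dk * dh) * (x₀ ^ 2 + x₁ ^ 2)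
        - 2 * -(x₀ * dn₁ - x₁ * dn₀) * (x₀ * dx₁ - x₁ * dx₀)
        + -(n₀ * x₀ + n₁ * x₁) * (dx₀ ^ 2 + dx₁ ^ 2 - dC ^ 2 + dh ^ 2)) /
      (2 * ((dx₀ ^ 2 + dx₁ ^ 2 - dC ^ 2 + dh ^ 2) * (x₀ ^ 2 + x₁ ^ 2) -
        (x₀ * dx₁ - x₁ * dx₀) ^ 2))) :
    (dC * k + dh * -n₂) / (C ^ 2 - 1) ≠ 0 ∧
    dC = (dC * k + dh * -n₂) / (C ^ 2 - 1) * k * (C ^ 2 - 1) ∧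
    -dn₂ = 2 * H * ((dC * k + dh * -n₂) / (C ^ 2 - 1) * k * (C ^ 2 - 1)) ∧
    dk = -((dC * k + dh * -n₂) / (C ^ 2 - 1) * -n₂ * (2 * H - -n₂ * C / (C ^ 2 - 1))) := by
  rw [meanCurvature_numerator_eq hD e1 d1 e2 e3 d2 d3, gram_eq e1 d1,
    eq_div_iff (mul_ne_zero two_ne_zero hne)] at hH
  have hW : (-n₂) ^ 2 = (C ^ 2 - 1) * (1 - k ^ 2) := by rw [neg_sq]; exact normal_sq e1 e2 e3 e5
  exact profile_system hD hW (by linear_combination d6) (normal_mul_deriv e1 d1 e2 e3 e4) hne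
    (by linear_combination hH)

end Algebra

/-! ### Curves on the sphere and their tangent vectors -/

theorem diffLR_clm_comp (L : LR →L[ℝ] LR) {f : S2 → LR} {p : S2}
    (hf : MDifferentiableAt (𝓡 2) 𝓘(ℝ, LR) f p) (u : TangentSpace (𝓡 2) p) :
    diffLR (fun q => L (f q)) p u = L (diffLR f p u) := by
  have h := (L.hasMFDerivAt (x := f p)).comp p hf.hasMFDerivAt
  exact DFunLike.congr_fun h.mfderiv u

theorem contMDiff_coe_S2 {n : ℕ∞ω} : ContMDiff (𝓡 2) 𝓘(ℝ, EuclideanSpace ℝ (Fin 3)) n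
    (fun p : S2 => (p : EuclideanSpace ℝ (Fin 3))) :=
  haveI := Fact.mk (finrank_euclideanSpace_fin (𝕜 := ℝ) (n := 2 + 1))
  contMDiff_coe_sphere

theorem contMDiff_S2_mk {n : ℕ∞ω} {E : Type*} [NormedAddCommGroup E] [NormedSpace ℝ E]
    {c : E → EuclideanSpace ℝ (Fin 3)} (hc : ContDiff ℝ n c)
    (h : ∀ t, c t ∈ Metric.sphere (0 : EuclideanSpace ℝ (Fin 3)) 1) :
    ContMDiff 𝓘(ℝ, E) (𝓡 2) n (fun t => (⟨c t, h t⟩ : S2)) :=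
  haveI := Fact.mk (finrank_euclideanSpace_fin (𝕜 := ℝ) (n := 2 + 1))
  ContMDiff.codRestrict_sphere hc.contMDiff h

/-- The velocity `u` of a curve in `S²`, characterised by its action on maps. The base point is a
separate variable `p`, so that curves through `p` whose value is only propositionally `p` give
vectors in the same tangent space. -/
theorem exists_tangent_of_curve {c : ℝ → S2} {t₀ : ℝ} {p : S2}
    (hc : MDifferentiableAt 𝓘(ℝ, ℝ) (𝓡 2) c t₀) (hp : c t₀ = p) :
    ∃ u : TangentSpace (𝓡 2) p, ∀ g : S2 → LR, MDifferentiableAt (𝓡 2) 𝓘(ℝ, LR) g p →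
      HasDerivAt (fun t => g (c t)) (diffLR g p u) t₀ := by
  subst hp
  refine ⟨mfderiv 𝓘(ℝ, ℝ) (𝓡 2) c t₀ (1 : ℝ), fun g hg => ?_⟩
  obtain ⟨D, hD, hD1⟩ : ∃ D : ℝ →L[ℝ] LR, HasFDerivAt (fun t => g (c t)) D t₀ ∧
      D 1 = diffLR g (c t₀) (mfderiv 𝓘(ℝ, ℝ) (𝓡 2) c t₀ (1 : ℝ)) :=
    ⟨_, (hg.hasMFDerivAt.comp t₀ hc.hasMFDerivAt).hasFDerivAt, rfl⟩
  rw [← hD1]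
  exact hD.hasDerivAt

/-- The inclusion of `S²` into `ℝ³ × {0}`, viewed in the same target as the immersions so that
`diffLR` applies to it; it serves to compare tangent vectors by their coordinates. -/
def sphereIncl (p : S2) : LR := ((p : EuclideanSpace ℝ (Fin 3)).ofLp, 0)

theorem mdifferentiable_sphereIncl : MDifferentiable (𝓡 2) 𝓘(ℝ, LR) sphereIncl := by
  have h1 : MDifferentiable (𝓡 2) 𝓘(ℝ, EuclideanSpace ℝ (Fin 3))
      (fun p : S2 => (p : EuclideanSpace ℝ (Fin 3))) :=
    (contMDiff_coe_S2 (n := 1)).mdifferentiable one_ne_zero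
  have h2 : Differentiable ℝ
      (fun x : EuclideanSpace ℝ (Fin 3) => ((x.ofLp, 0) : LR)) := by fun_prop
  exact h2.mdifferentiable.comp h1

/-- The great circle of `S²` through the two poles of the rotation, at `t = 0` and `t = π`. -/
def meridian (t : ℝ) : S2 :=
  ⟨WithLp.toLp 2 ![Real.sin t, 0, Real.cos t], by
    rw [mem_sphere_zero_iff_norm, EuclideanSpace.norm_eq, Real.sqrt_eq_one]
    simp [Fin.sum_univ_three]⟩

theorem contMDiff_meridian {n : ℕ∞ω} : ContMDiff 𝓘(ℝ, ℝ) (𝓡 2) n meridian := by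
  refine contMDiff_S2_mk (c := fun t => WithLp.toLp 2 ![Real.sin t, 0, Real.cos t]) ?_ _
  rw [contDiff_euclidean]
  intro i
  fin_cases i
  · exact Real.contDiff_sin
  · exact contDiff_const
  · exact Real.contDiff_cos

theorem mdifferentiable_rotSphere (p : S2) :
    MDifferentiable 𝓘(ℝ, ℝ) (𝓡 2) (fun θ => rotSphere θ p) := by
  refine ContMDiff.mdifferentiable (n := 1) ?_ one_ne_zero
  refine contMDiff_S2_mk (c := fun θ => WithLp.toLp 2
    (rot θ (p : EuclideanSpace ℝ (Fin 3)).ofLp)) ?_ _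
  rw [contDiff_euclidean]
  intro i
  fin_cases i <;> simp [rot] <;> fun_prop

theorem rotSphere_zero (p : S2) : rotSphere 0 p = p := by
  apply Subtype.ext
  ext i
  fin_cases i <;> simp [rotSphere, rot]

/-- The half turn about the axis reverses the great circle at each pole. -/
theorem meridian_reflect {t₀ : ℝ} (h0 : Real.sin t₀ = 0) (t : ℝ) :
    meridian (2 * t₀ - t) = rotSphere Real.pi (meridian t) := by
  apply Subtype.ext
  ext i
  have h1 : Real.sin (2 * t₀) = 0 := by rw [Real.sin_two_mul, h0]; ring
  have h2 : Real.cos (2 * t₀) = 1 := by rw [Real.cos_two_mul']; nlinarith [Real.sin_sq_add_cos_sq t₀]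
  fin_cases i <;> simp [rotSphere, rot, meridian, Real.sin_sub, Real.cos_sub, h1, h2]

theorem rotSphere_meridian_of_sin_eq_zero {t₀ : ℝ} (h0 : Real.sin t₀ = 0) (θ : ℝ) :
    rotSphere θ (meridian t₀) = meridian t₀ := by
  apply Subtype.ext
  ext i
  fin_cases i <;> simp [rotSphere, rot, meridian, h0]

/-! ### Moving the axis to the standard one -/

section Normalize

theorem IsHypIsometry.symm {A : (Fin 3 → ℝ) ≃ₗ[ℝ] (Fin 3 → ℝ)} (hA : IsHypIsometry A) :
    IsHypIsometry A.symm := by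
  have hl : ∀ v w, lorentz (A.symm v) (A.symm w) = lorentz v w := fun v w => by
    rw [← hA.1]; simp
  refine ⟨hl, fun x hx => ⟨by rw [hl]; exact hx.1, ?_⟩⟩
  by_contra hn
  have h1 : lorentz (A.symm x) (A.symm x) = -1 := by rw [hl]; exact hx.1
  have h2 : A.symm x 2 ≠ 0 := fun e => by
    simp only [lorentz, e] at h1; nlinarith
  have h3 : -A.symm x ∈ hypPlane := by
    refine ⟨by simpa [lorentz] using h1, ?_⟩
    simpa using lt_of_le_of_ne (not_lt.mp hn) h2
  have h4 := (hA.2 _ h3).2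
  rw [map_neg, A.apply_symm_apply] at h4
  have := hx.2
  simp at h4
  linarith

/-- A linear isometry of `ℍ²`, extended to `𝕃³ × ℝ` by the identity of the heights. -/
def hypIsometryProd (A : (Fin 3 → ℝ) ≃ₗ[ℝ] (Fin 3 → ℝ)) : LR →L[ℝ] LR :=
  (A.toContinuousLinearEquiv : (Fin 3 → ℝ) →L[ℝ] (Fin 3 → ℝ)).prodMap (ContinuousLinearMap.id ℝ ℝ)

theorem hypIsometryProd_apply (A : (Fin 3 → ℝ) ≃ₗ[ℝ] (Fin 3 → ℝ)) (x : LR) :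
    hypIsometryProd A x = (A x.1, x.2) := rfl

theorem IsHSphere.hypIsometryProd_comp {H : ℝ → ℝ} {f η : S2 → LR} (h : IsHSphere H f η)
    {A : (Fin 3 → ℝ) ≃ₗ[ℝ] (Fin 3 → ℝ)} (hA : IsHypIsometry A) :
    IsHSphere H (fun p => hypIsometryProd A (f p)) (fun p => hypIsometryProd A (η p)) := by
  have hf := h.immersed.contMDiff.mdifferentiable two_ne_zero
  have hη := h.unitNormal.contMDiff.mdifferentiable one_ne_zero
  have hm : ∀ v w, metricLR (hypIsometryProd A v) (hypIsometryProd A w) = metricLR v w :=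
    fun v w => by simp [metricLR, hypIsometryProd_apply, hA.1]
  have hdf : ∀ p u, diffLR (fun p => hypIsometryProd A (f p)) p u =
    hypIsometryProd A (diffLR f p u) := fun p u => diffLR_clm_comp _ (hf p) u
  have hdη : ∀ p u, diffLR (fun p => hypIsometryProd A (η p)) p u =
    hypIsometryProd A (diffLR η p u) := fun p u => diffLR_clm_comp _ (hη p) u
  refine ⟨⟨fun p => hA.2 _ (h.immersed.mem p),
    (hypIsometryProd A).contDiff.contMDiff.comp h.immersed.contMDiff, fun p => ?_⟩,
    ⟨(hypIsometryProd A).contDiff.contMDiff.comp h.unitNormal.contMDiff, fun p => ?_,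
      fun p u => ?_, fun p => ?_⟩, fun p u v huv => ?_⟩
  · intro u v huv
    rw [hdf, hdf] at huv
    apply h.immersed.injective p
    simp only [hypIsometryProd_apply, Prod.mk.injEq] at huv
    exact Prod.ext (A.injective huv.1) huv.2
  · simpa [hypIsometryProd_apply, hA.1] using h.unitNormal.tangent p
  · rw [hdf, hm]; exact h.unitNormal.normal p u
  · rw [hm]; exact h.unitNormal.unit p
  · have := h.meanCurvature p u v huv
    simp only [secondForm, firstForm, hdf, hdη, hm] at this ⊢
    simpa [angleFunction, metricLR, hypIsometryProd_apply, lorentz, verticalField] using this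

end Normalize

/-- An `H`-sphere that is rotational about the axis over the point `(0, 0, 1)` of `ℍ²`. -/
structure IsStdRotHSphere (H : ℝ → ℝ) (f η : S2 → LR) : Prop extends IsHSphere H f η where
  rot_eq : ∀ (θ : ℝ) (p : S2), f (rotSphere θ p) = (rot θ (f p).1, (f p).2)

theorem IsHSphere.exists_isStdRotHSphere {H : ℝ → ℝ} {f η : S2 → LR} (h : IsHSphere H f η)
    (hr : IsRotational f) : ∃ f' η', IsStdRotHSphere H f' η' := by
  obtain ⟨A, hA, hrot⟩ := hr
  refine ⟨_, _, h.hypIsometryProd_comp hA.symm, fun θ p => ?_⟩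
  simp [hrot, hypIsometryProd_apply]

/-! ### Geometry along an orbit of the rotation -/

namespace IsStdRotHSphere

variable {H : ℝ → ℝ} {f η : S2 → LR}

theorem mdiff_f (h : IsStdRotHSphere H f η) : MDifferentiable (𝓡 2) 𝓘(ℝ, LR) f :=
  h.immersed.contMDiff.mdifferentiable two_ne_zero

theorem mdiff_η (h : IsStdRotHSphere H f η) : MDifferentiable (𝓡 2) 𝓘(ℝ, LR) η :=
  h.unitNormal.contMDiff.mdifferentiable one_ne_zero

theorem hasDerivAt_rot (h : IsStdRotHSphere H f η) (p : S2) (θ : ℝ) :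
    HasDerivAt (fun θ => f (rotSphere θ p))
      (![-Real.sin θ * (f p).1 0 - Real.cos θ * (f p).1 1,
        Real.cos θ * (f p).1 0 - Real.sin θ * (f p).1 1, 0], 0) θ := by
  simp only [h.rot_eq]
  refine HasDerivAt.prodMk ?_ (hasDerivAt_const _ _)
  rw [hasDerivAt_pi]
  intro i
  have hs := Real.hasDerivAt_sin θ
  have hc := Real.hasDerivAt_cos θ
  fin_cases i
  · exact (hc.mul_const _).sub (hs.mul_const _)
  · exact ((hs.mul_const _).add (hc.mul_const _)).congr_deriv (by simp; ring)
  · exact hasDerivAt_const _ _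

/-- The normal is orthogonal to the orbit of `p`, at each of its points. -/
theorem normal_rot (h : IsStdRotHSphere H f η) (p : S2) (θ : ℝ) :
    (η (rotSphere θ p)).1 0 * (-Real.sin θ * (f p).1 0 - Real.cos θ * (f p).1 1) +
      (η (rotSphere θ p)).1 1 * (Real.cos θ * (f p).1 0 - Real.sin θ * (f p).1 1) = 0 := by
  obtain ⟨V, hV⟩ := exists_tangent_of_curve (mdifferentiable_rotSphere p θ) rfl
  have h1 := h.unitNormal.normal (rotSphere θ p) V
  rw [(hV f (h.mdiff_f _)).unique (h.hasDerivAt_rot p θ)] at h1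
  simpa [metricLR, lorentz] using h1

/-- The velocity `V` of the rotation at `p`. The value of `⟨dη V, df V⟩` comes from differentiating
`normal_rot` in the angle, without knowing that `η` is itself equivariant. -/
theorem exists_tangent_parallel (h : IsStdRotHSphere H f η) (p : S2) :
    ∃ V : TangentSpace (𝓡 2) p, diffLR f p V = (![-(f p).1 1, (f p).1 0, 0], 0) ∧
      diffLR sphereIncl p V = (![-(p : EuclideanSpace ℝ (Fin 3)).ofLp 1,
        (p : EuclideanSpace ℝ (Fin 3)).ofLp 0, 0], 0) ∧
      metricLR (diffLR η p V) (diffLR f p V) = (η p).1 0 * (f p).1 0 + (η p).1 1 * (f p).1 1 := by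
  obtain ⟨V, hV⟩ := exists_tangent_of_curve (mdifferentiable_rotSphere p 0) (rotSphere_zero p)
  have h1 : diffLR f p V = (![-(f p).1 1, (f p).1 0, 0], 0) := by
    rw [(hV f (h.mdiff_f _)).unique (h.hasDerivAt_rot p 0)]
    simp
  refine ⟨V, h1, ?_, ?_⟩
  · refine (hV _ (mdifferentiable_sphereIncl _)).unique ?_
    refine HasDerivAt.prodMk ?_ (hasDerivAt_const _ _)
    rw [hasDerivAt_pi]
    intro i
    have hs := Real.hasDerivAt_sin 0
    have hc := Real.hasDerivAt_cos 0
    fin_cases i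
    · exact ((hc.mul_const _).sub (hs.mul_const _)).congr_deriv (by simp)
    · exact ((hs.mul_const _).add (hc.mul_const _)).congr_deriv (by simp)
    · exact hasDerivAt_const _ _
  · have hZ := hV η (h.mdiff_η _)
    have hZ1 := hasDerivAt_pi.1 (hZ.fst)
    have hs := Real.hasDerivAt_sin 0
    have hc := Real.hasDerivAt_cos 0
    have hd := ((hZ1 0).mul (((hs.neg.mul_const ((f p).1 0))).sub (hc.mul_const ((f p).1 1)))).add
      ((hZ1 1).mul (((hc.mul_const ((f p).1 0))).sub (hs.mul_const ((f p).1 1))))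
    have h0 := hd.unique ((hasDerivAt_const (0 : ℝ) (0 : ℝ)).congr_of_eventuallyEq
      (Filter.Eventually.of_forall fun θ => h.normal_rot p θ))
    simp [rotSphere_zero] at h0
    rw [h1]
    simp [metricLR, lorentz]
    linarith

end IsStdRotHSphere

/-! ### Geometry along the meridian -/

theorem diffLR_smul_add_smul (g : S2 → LR) (p : S2) (a b : ℝ) (u v : TangentSpace (𝓡 2) p) :
    diffLR g p (a • u + b • v) = a • diffLR g p u + b • diffLR g p v := by
  unfold diffLR
  rw [map_add, map_smul, map_smul]
  rfl

theorem diffLR_zero (g : S2 → LR) (p : S2) : diffLR g p 0 = 0 := by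
  unfold diffLR
  exact map_zero _

theorem hasDerivAt_fst_apply {γ : ℝ → LR} {v : LR} {t : ℝ} (h : HasDerivAt γ v t) (i : Fin 3) :
    HasDerivAt (fun s => (γ s).1 i) (v.1 i) t := by
  have h1 : HasDerivAt (fun s => (γ s).1) v.1 t :=
    (ContinuousLinearMap.fst ℝ (Fin 3 → ℝ) ℝ).hasFDerivAt.comp_hasDerivAt t h
  exact hasDerivAt_pi.1 h1 i

theorem hasDerivAt_snd {γ : ℝ → LR} {v : LR} {t : ℝ} (h : HasDerivAt γ v t) :
    HasDerivAt (fun s => (γ s).2) v.2 t :=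
  (ContinuousLinearMap.snd ℝ (Fin 3 → ℝ) ℝ).hasFDerivAt.comp_hasDerivAt t h

theorem mdifferentiable_rotSphere_meridian (θ : ℝ) :
    MDifferentiable 𝓘(ℝ, ℝ) (𝓡 2) (fun t => rotSphere θ (meridian t)) := by
  refine ContMDiff.mdifferentiable (n := 1) ?_ one_ne_zero
  refine contMDiff_S2_mk (c := fun t => WithLp.toLp 2
    (rot θ ![Real.sin t, 0, Real.cos t])) ?_ _
  rw [contDiff_euclidean]
  intro i
  fin_cases i <;> simp [rot] <;> fun_prop

theorem exists_tangent_meridian (t : ℝ) :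
    ∃ P : TangentSpace (𝓡 2) (meridian t),
      (∀ g : S2 → LR, MDifferentiable (𝓡 2) 𝓘(ℝ, LR) g →
        HasDerivAt (fun t => g (meridian t)) (diffLR g (meridian t) P) t) ∧
      diffLR sphereIncl (meridian t) P = (![Real.cos t, 0, -Real.sin t], 0) := by
  obtain ⟨P, hP⟩ := exists_tangent_of_curve
    ((contMDiff_meridian (n := 1)).mdifferentiable one_ne_zero t) rfl
  refine ⟨P, fun g hg => hP g (hg _), (hP _ (mdifferentiable_sphereIncl _)).unique ?_⟩
  refine HasDerivAt.prodMk ?_ (hasDerivAt_const _ _)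
  rw [hasDerivAt_pi]
  intro i
  fin_cases i
  · exact Real.hasDerivAt_sin t
  · exact hasDerivAt_const _ _
  · exact Real.hasDerivAt_cos t

/-- A point `x` of the surface with an independent pair of tangent vectors, the meridian velocity
`v` and the velocity of the rotation, is off the axis, and `v` has a component transverse to the
orbit. -/
theorem coords_of_independent {x v : LR}
    (e1 : x.1 0 ^ 2 + x.1 1 ^ 2 = x.1 2 ^ 2 - 1)
    (d1 : x.1 0 * v.1 0 + x.1 1 * v.1 1 = x.1 2 * v.1 2)
    (hinj : ∀ a b : ℝ, a • v + b • ((![-x.1 1, x.1 0, 0], 0) : LR) = 0 → a = 0 ∧ b = 0) :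
    0 < x.1 2 ^ 2 - 1 ∧ v.1 2 ^ 2 + v.2 ^ 2 * (x.1 2 ^ 2 - 1) ≠ 0 := by
  have hD : 0 < x.1 2 ^ 2 - 1 := by
    refine lt_of_le_of_ne (e1 ▸ by positivity) fun e => ?_
    rw [← e] at e1
    have hx0 : x.1 0 = 0 := by nlinarith [sq_nonneg (x.1 0), sq_nonneg (x.1 1)]
    have hx1 : x.1 1 = 0 := by nlinarith [sq_nonneg (x.1 0), sq_nonneg (x.1 1)]
    have := hinj 0 1 (Prod.ext (funext fun i => by fin_cases i <;> simp [hx0, hx1]) (by simp))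
    exact one_ne_zero this.2
  refine ⟨hD, fun e => ?_⟩
  have hdC : v.1 2 = 0 := pow_eq_zero_iff two_ne_zero |>.1
    (le_antisymm (e ▸ le_add_of_nonneg_right (by positivity)) (sq_nonneg _))
  have hdh : v.2 = 0 := by
    rw [hdC] at e
    have : v.2 ^ 2 * (x.1 2 ^ 2 - 1) = 0 := by linarith
    exact pow_eq_zero_iff two_ne_zero |>.1 ((mul_eq_zero.1 this).resolve_right hD.ne')
  rw [hdC] at d1
  have := hinj (x.1 2 ^ 2 - 1) (-(x.1 0 * v.1 1 - x.1 1 * v.1 0))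
    (Prod.ext (funext fun i => by
      fin_cases i
      · simp
        linear_combination x.1 0 * d1 - v.1 0 * e1
      · simp
        linear_combination x.1 1 * d1 - v.1 1 * e1
      · simp [hdC]) (by simp [hdh]))
  exact hD.ne' this.1

namespace IsStdRotHSphere

variable {H : ℝ → ℝ} {f η : S2 → LR}

theorem f_sq (h : IsStdRotHSphere H f η) (p : S2) :
    (f p).1 0 ^ 2 + (f p).1 1 ^ 2 = (f p).1 2 ^ 2 - 1 := by
  have := (h.immersed.mem p).1
  simp only [lorentz] at this
  linarith

theorem η_tangent (h : IsStdRotHSphere H f η) (p : S2) :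
    (η p).1 0 * (f p).1 0 + (η p).1 1 * (f p).1 1 = (η p).1 2 * (f p).1 2 := by
  have := h.unitNormal.tangent p
  simp only [lorentz] at this
  linarith

theorem η_parallel (h : IsStdRotHSphere H f η) (p : S2) :
    (η p).1 1 * (f p).1 0 = (η p).1 0 * (f p).1 1 := by
  have := h.normal_rot p 0
  simp [rotSphere_zero] at this
  linarith

theorem η_sq (h : IsStdRotHSphere H f η) (p : S2) :
    (η p).1 0 ^ 2 + (η p).1 1 ^ 2 - (η p).1 2 ^ 2 + (η p).2 ^ 2 = 1 := by
  have := h.unitNormal.unit p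
  simp only [metricLR, lorentz] at this
  linarith

/-- In the notation of `IsProfile`: `(sinh ρ sin φ)² = (cosh² ρ - 1) (1 - cos² φ)`. -/
theorem η_two_sq (h : IsStdRotHSphere H f η) (p : S2) :
    (η p).1 2 ^ 2 = ((f p).1 2 ^ 2 - 1) * (1 - (η p).2 ^ 2) :=
  normal_sq (h.f_sq p) (h.η_tangent p) (h.η_parallel p) (h.η_sq p)

/-- At a pole the surface meets the axis, with horizontal tangent plane: the half turn about the axis
reverses the velocity of the meridian, which is therefore horizontal, and so is its image under a
quarter turn. -/
theorem pole (h : IsStdRotHSphere H f η) {t₀ : ℝ} (h0 : Real.sin t₀ = 0) :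
    (f (meridian t₀)).1 2 = 1 ∧ (η (meridian t₀)).1 2 = 0 ∧ (η (meridian t₀)).2 ^ 2 = 1 := by
  have hfix := h.rot_eq Real.pi (meridian t₀)
  rw [rotSphere_meridian_of_sin_eq_zero h0] at hfix
  have hx0 : (f (meridian t₀)).1 0 = 0 := by
    have := congrFun (congrArg Prod.fst hfix) 0
    simp [rot] at this
    linarith
  have hx1 : (f (meridian t₀)).1 1 = 0 := by
    have := congrFun (congrArg Prod.fst hfix) 1
    simp [rot] at this
    linarith
  have hC : (f (meridian t₀)).1 2 = 1 := by
    have h1 := h.f_sq (meridian t₀)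
    have h2 := (h.immersed.mem (meridian t₀)).2
    rw [hx0, hx1] at h1
    have : ((f (meridian t₀)).1 2 - 1) * ((f (meridian t₀)).1 2 + 1) = 0 := by linarith
    rcases mul_eq_zero.mp this with e | e <;> linarith
  obtain ⟨P, hP, hPi⟩ := exists_tangent_meridian t₀
  have hd := hP f h.mdiff_f
  have hd1 := hasDerivAt_fst_apply hd
  have hd2 := hasDerivAt_snd hd
  have hrev : HasDerivAt (fun t => 2 * t₀ - t) (-1) t₀ := by
    simpa using (hasDerivAt_id t₀).const_sub (2 * t₀)
  have hself : t₀ = 2 * t₀ - t₀ := by ring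
  have hr : ∀ t, f (meridian (2 * t₀ - t)) =
      (rot Real.pi (f (meridian t)).1, (f (meridian t)).2) := fun t => by
    rw [meridian_reflect h0, h.rot_eq]
  have hv2 : (diffLR f (meridian t₀) P).2 = 0 := by
    have h1 := (HasDerivAt.comp_of_eq t₀ hd2 hrev hself).congr_of_eventuallyEq (f₁ := fun t =>
      (f (meridian t)).2) (Filter.Eventually.of_forall fun t => by simp [hr])
    have := h1.unique hd2
    linarith
  have hv12 : (diffLR f (meridian t₀) P).1 2 = 0 := by
    have h1 := (HasDerivAt.comp_of_eq t₀ (hd1 2) hrev hself).congr_of_eventuallyEq (f₁ := fun t =>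
      (f (meridian t)).1 2) (Filter.Eventually.of_forall fun t => by simp [hr, rot])
    have := h1.unique (hd1 2)
    linarith
  obtain ⟨Q, hQ⟩ := exists_tangent_of_curve (c := fun t => rotSphere (Real.pi / 2) (meridian t))
    (t₀ := t₀) (p := meridian t₀) (mdifferentiable_rotSphere_meridian _ _)
    (rotSphere_meridian_of_sin_eq_zero h0 _)
  have hQf : diffLR f (meridian t₀) Q =
      (![-(diffLR f (meridian t₀) P).1 1, (diffLR f (meridian t₀) P).1 0, 0], 0) := by
    refine (hQ f (h.mdiff_f _)).unique ?_
    simp only [h.rot_eq]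
    refine HasDerivAt.prodMk ?_ (by simpa [hv2] using hd2)
    rw [hasDerivAt_pi]
    intro i
    fin_cases i
    · simpa [rot] using (hd1 1).fun_neg
    · simpa [rot] using hd1 0
    · simpa [rot, hv12] using hd1 2
  have hn1 := h.unitNormal.normal _ P
  have hn2 := h.unitNormal.normal _ Q
  rw [hQf] at hn2
  simp [metricLR, lorentz, hv2, hv12] at hn1 hn2
  have hne : diffLR f (meridian t₀) P ≠ 0 := by
    intro e
    have e0 : P = 0 := by
      apply h.immersed.injective (meridian t₀)
      rw [e, diffLR_zero]
    rw [e0, diffLR_zero] at hPi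
    have h1 : 0 = Real.cos t₀ := congrFun (congrArg Prod.fst hPi) 0
    have h2 := Real.sin_sq_add_cos_sq t₀
    rw [h0, ← h1] at h2
    norm_num at h2
  set v := diffLR f (meridian t₀) P with hv
  have hpos : v.1 0 ^ 2 + v.1 1 ^ 2 ≠ 0 := by
    intro e
    apply hne
    refine Prod.ext (funext fun i => ?_) hv2
    fin_cases i
    · exact pow_eq_zero_iff two_ne_zero |>.1
        (le_antisymm (e ▸ le_add_of_nonneg_right (sq_nonneg (v.1 1))) (sq_nonneg _))
    · exact pow_eq_zero_iff two_ne_zero |>.1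
        (le_antisymm (e ▸ le_add_of_nonneg_left (sq_nonneg (v.1 0))) (sq_nonneg _))
    · exact hv12
  have hη0 : (η (meridian t₀)).1 0 = 0 := by
    refine (mul_eq_zero.mp (?_ : (v.1 0 ^ 2 + v.1 1 ^ 2) * _ = 0)).resolve_left hpos
    linear_combination v.1 0 * hn1 - v.1 1 * hn2
  have hη1 : (η (meridian t₀)).1 1 = 0 := by
    refine (mul_eq_zero.mp (?_ : (v.1 0 ^ 2 + v.1 1 ^ 2) * _ = 0)).resolve_left hpos
    linear_combination v.1 1 * hn1 + v.1 0 * hn2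
  have hη2 := h.η_tangent (meridian t₀)
  rw [hx0, hx1, hC] at hη2
  have hη2 : (η (meridian t₀)).1 2 = 0 := by linarith
  have := h.η_sq (meridian t₀)
  rw [hη0, hη1, hη2] at this
  exact ⟨hC, hη2, by linarith⟩

/-- The function `μ` of `IsProfile`, up to sign: the speed of the meridian, after removing its
component along the orbits, divided by `sinh ρ`. The formula is
`(C' k + z' W) / (C ^ 2 - 1)` with `z` the height. It is junk at the poles, where the denominator
vanishes. -/
def speedRatio (f η : S2 → LR) (t : ℝ) : ℝ :=
  (deriv (fun t => (f (meridian t)).1 2) t * (η (meridian t)).2 +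
    deriv (fun t => (f (meridian t)).2) t * -(η (meridian t)).1 2) /
    ((f (meridian t)).1 2 ^ 2 - 1)

/-- Away from the poles the meridian satisfies the equations of `IsProfile`, with
`C = (f ·).1 2`, `W = -(η ·).1 2` and `k = (η ·).2`. -/
theorem profile_at (h : IsStdRotHSphere H f η) {t : ℝ} (ht : Real.sin t ≠ 0) :
    1 < (f (meridian t)).1 2 ∧
    (-(η (meridian t)).1 2) ^ 2 = ((f (meridian t)).1 2 ^ 2 - 1) * (1 - (η (meridian t)).2 ^ 2) ∧
    speedRatio f η t ≠ 0 ∧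
    HasDerivAt (fun t => (f (meridian t)).1 2)
      (speedRatio f η t * (η (meridian t)).2 * ((f (meridian t)).1 2 ^ 2 - 1)) t ∧
    HasDerivAt (fun t => -(η (meridian t)).1 2)
      (2 * H (η (meridian t)).2 *
        (speedRatio f η t * (η (meridian t)).2 * ((f (meridian t)).1 2 ^ 2 - 1))) t ∧
    HasDerivAt (fun t => (η (meridian t)).2)
      (-(speedRatio f η t * -(η (meridian t)).1 2 * (2 * H (η (meridian t)).2 -
        -(η (meridian t)).1 2 * (f (meridian t)).1 2 / ((f (meridian t)).1 2 ^ 2 - 1)))) t := by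
  obtain ⟨P, hP, hPi⟩ := exists_tangent_meridian t
  obtain ⟨V, hV, hVi, hVη⟩ := h.exists_tangent_parallel (meridian t)
  have hind : ∀ a b : ℝ, a • P + b • V = 0 → a = 0 ∧ b = 0 := by
    intro a b hab
    have h1 := diffLR_smul_add_smul sphereIncl (meridian t) a b P V
    rw [hab, hPi, hVi] at h1
    rw [diffLR_zero] at h1
    have e1 := congrFun (congrArg Prod.fst h1) 1
    have e2 := congrFun (congrArg Prod.fst h1) 2
    simp [meridian, ht] at e1 e2
    exact ⟨e2, e1⟩
  have hinj : ∀ a b : ℝ, a • diffLR f (meridian t) P + b • diffLR f (meridian t) V = 0 →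
      a = 0 ∧ b = 0 := by
    intro a b hab
    apply hind
    apply h.immersed.injective (meridian t)
    rw [diffLR_smul_add_smul, hab, diffLR_zero]
  have hfP := hP f h.mdiff_f
  have hηP := hP η h.mdiff_η
  have hmc := h.meanCurvature (meridian t) P V (LinearIndependent.pair_iff.2 hind)
  have hnP := h.unitNormal.normal (meridian t) P
  have hdx := hasDerivAt_fst_apply hfP
  have hdn := hasDerivAt_fst_apply hηP
  have hdz := hasDerivAt_snd hfP
  have hdk := hasDerivAt_snd hηP
  have e1 := h.f_sq (meridian t)
  have e2 := h.η_tangent (meridian t)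
  have e3 := h.η_parallel (meridian t)
  have e5 := h.η_sq (meridian t)
  have d1 := (((hdx 0).pow 2).add ((hdx 1).pow 2)).unique
    ((((hdx 2).pow 2).sub_const 1).congr_of_eventuallyEq
      (Filter.Eventually.of_forall fun s => h.f_sq (meridian s)))
  have d2 := (((hdn 0).mul (hdx 0)).add ((hdn 1).mul (hdx 1))).unique
    (((hdn 2).mul (hdx 2)).congr_of_eventuallyEq
      (Filter.Eventually.of_forall fun s => h.η_tangent (meridian s)))
  have d3 := ((hdn 1).mul (hdx 0)).unique
    (((hdn 0).mul (hdx 1)).congr_of_eventuallyEq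
      (Filter.Eventually.of_forall fun s => h.η_parallel (meridian s)))
  have d6 := ((hdn 2).pow 2).unique
    (((((hdx 2).pow 2).sub_const 1).mul ((hdk.pow 2).const_sub 1)).congr_of_eventuallyEq
      (Filter.Eventually.of_forall fun s => h.η_two_sq (meridian s)))
  have hang : angleFunction η (meridian t) = (η (meridian t)).2 := by
    simp [angleFunction, metricLR, lorentz, verticalField]
  have hC0 := (h.immersed.mem (meridian t)).2
  have hE : firstForm f (meridian t) P P = (diffLR f (meridian t) P).1 0 ^ 2 +
      (diffLR f (meridian t) P).1 1 ^ 2 - (diffLR f (meridian t) P).1 2 ^ 2 +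
      (diffLR f (meridian t) P).2 ^ 2 := by
    simp only [firstForm, metricLR, lorentz]; ring
  have hF : firstForm f (meridian t) P V = (f (meridian t)).1 0 * (diffLR f (meridian t) P).1 1 -
      (f (meridian t)).1 1 * (diffLR f (meridian t) P).1 0 := by
    simp [firstForm, hV, metricLR, lorentz]; ring
  have hG : firstForm f (meridian t) V V =
      (f (meridian t)).1 0 ^ 2 + (f (meridian t)).1 1 ^ 2 := by
    simp [firstForm, hV, metricLR, lorentz]; ring
  have he : secondForm f η (meridian t) P P =
      -((diffLR η (meridian t) P).1 0 * (diffLR f (meridian t) P).1 0 +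
        (diffLR η (meridian t) P).1 1 * (diffLR f (meridian t) P).1 1 -
        (diffLR η (meridian t) P).1 2 * (diffLR f (meridian t) P).1 2 +
        (diffLR η (meridian t) P).2 * (diffLR f (meridian t) P).2) := by
    simp only [secondForm, metricLR, lorentz]
  have hff : secondForm f η (meridian t) P V =
      -((f (meridian t)).1 0 * (diffLR η (meridian t) P).1 1 -
        (f (meridian t)).1 1 * (diffLR η (meridian t) P).1 0) := by
    simp [secondForm, hV, metricLR, lorentz]; ring
  have hg : secondForm f η (meridian t) V V =
      -((η (meridian t)).1 0 * (f (meridian t)).1 0 +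
        (η (meridian t)).1 1 * (f (meridian t)).1 1) := by
    rw [secondForm, hVη]
  rw [hang, hE, hF, hG, he, hff, hg] at hmc
  simp only [metricLR, lorentz] at hnP
  simp only [Pi.pow_apply, Nat.add_one_sub_one, pow_one, Nat.cast_ofNat] at d1 d6
  rw [hV] at hinj
  rw [speedRatio, (hdx 2).deriv, hdz.deriv]
  have d1' := show (f (meridian t)).1 0 * (diffLR f (meridian t) P).1 0 +
      (f (meridian t)).1 1 * (diffLR f (meridian t) P).1 1 =
      (f (meridian t)).1 2 * (diffLR f (meridian t) P).1 2 by linarith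
  obtain ⟨hD, hne⟩ := coords_of_independent e1 d1' hinj
  obtain ⟨hμ, r1, r2, r3⟩ := profile_system_of_forms hD e1 d1' e2 e3 d2 d3 hnP e5
    (by linear_combination d6) hne hmc
  exact ⟨by nlinarith, by rw [neg_sq]; exact h.η_two_sq _, hμ, (hdx 2).congr_deriv r1,
    (hdn 2).fun_neg.congr_deriv r2, hdk.congr_deriv r3⟩

end IsStdRotHSphere

/-! ### The profile of a rotational sphere -/

/-- The meridian leaves the axis at the first pole, so it does not start with `k < 0`. -/
theorem nonneg_of_hasDerivAt_of_lt {C k μ : ℝ → ℝ} {b : ℝ} (hb : 0 < b) (hC : Continuous C)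
    (hk : Continuous k) (hC0 : C 0 = 1) (hC1 : ∀ t ∈ Set.Ioo 0 b, 1 < C t)
    (hμ : ∀ t ∈ Set.Ioo 0 b, 0 < μ t)
    (hd : ∀ t ∈ Set.Ioo 0 b, HasDerivAt C (μ t * k t * (C t ^ 2 - 1)) t) : 0 ≤ k 0 := by
  by_contra! hn
  obtain ⟨u, hu, hsub⟩ := mem_nhdsGE_iff_exists_Ico_subset.1
    ((hk.tendsto 0).mono_left nhdsWithin_le_nhds (Iio_mem_nhds hn) :
      k ⁻¹' Set.Iio 0 ∈ nhdsWithin 0 (Set.Ici 0))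
  obtain ⟨δ, hδ0, hδ⟩ := exists_between (lt_min hb hu)
  obtain ⟨hδb, hδu⟩ := lt_min_iff.1 hδ
  have hanti : AntitoneOn C (Set.Icc 0 δ) := by
    refine antitoneOn_of_deriv_nonpos (convex_Icc 0 δ) hC.continuousOn (fun t ht => ?_)
      (fun t ht => ?_) <;> rw [interior_Icc] at ht
    · exact (hd t ⟨ht.1, ht.2.trans hδb⟩).differentiableAt.differentiableWithinAt
    · have hm : t ∈ Set.Ioo 0 b := ⟨ht.1, ht.2.trans hδb⟩
      rw [(hd t hm).deriv]
      have h1 : k t < 0 := hsub ⟨ht.1.le, ht.2.trans hδu⟩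
      have h2 : 0 < C t ^ 2 - 1 := by nlinarith [hC1 t hm]
      exact mul_nonpos_of_nonpos_of_nonneg
        (mul_nonpos_of_nonneg_of_nonpos (hμ t hm).le h1.le) h2.le
  have := hanti ⟨le_rfl, hδ0.le⟩ ⟨hδ0.le, le_rfl⟩ hδ0.le
  linarith [hC1 δ ⟨hδ0, hδb⟩]

/-- Horizontal tangent planes at the poles, together with `0 < μ`, force the values `1` and `-1` of
the angle function there. -/
theorem IsProfile.of_sq_eq_one {H C W k μ : ℝ → ℝ} (hC : Continuous C) (hW : Continuous W)
    (hk : Continuous k) (hC0 : C 0 = 1) (hCpi : C Real.pi = 1)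
    (hC1 : ∀ t ∈ Set.Ioo 0 Real.pi, 1 < C t)
    (hWsq : ∀ t ∈ Set.Icc 0 Real.pi, W t ^ 2 = (C t ^ 2 - 1) * (1 - k t ^ 2))
    (hk0 : k 0 ^ 2 = 1) (hkpi : k Real.pi ^ 2 = 1) (hμ : ∀ t ∈ Set.Ioo 0 Real.pi, 0 < μ t)
    (hdC : ∀ t ∈ Set.Ioo 0 Real.pi, HasDerivAt C (μ t * k t * (C t ^ 2 - 1)) t)
    (hdW : ∀ t ∈ Set.Ioo 0 Real.pi,
      HasDerivAt W (2 * H (k t) * (μ t * k t * (C t ^ 2 - 1))) t)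
    (hdk : ∀ t ∈ Set.Ioo 0 Real.pi,
      HasDerivAt k (-(μ t * W t * (2 * H (k t) - W t * C t / (C t ^ 2 - 1)))) t) :
    IsProfile H C W k μ := by
  refine ⟨hC, hW, hk, hC0, hCpi, hC1, hWsq, ?_, ?_, hμ, hdC, hdW, hdk⟩
  · have := nonneg_of_hasDerivAt_of_lt Real.pi_pos hC hk hC0 hC1 hμ hdC
    rcases (sq_eq_sq_iff_eq_or_eq_neg.1 (hk0.trans (one_pow 2).symm)) with e | e <;> linarith
  · have hm : ∀ t ∈ Set.Ioo 0 Real.pi, Real.pi - t ∈ Set.Ioo 0 Real.pi := fun t ht =>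
      ⟨by linarith [ht.2], by linarith [ht.1]⟩
    have hs : ∀ t, HasDerivAt (fun t => Real.pi - t) (-1) t := fun t => by
      simpa using (hasDerivAt_id t).const_sub Real.pi
    have := nonneg_of_hasDerivAt_of_lt (C := fun t => C (Real.pi - t))
      (k := fun t => -k (Real.pi - t)) (μ := fun t => μ (Real.pi - t)) Real.pi_pos
      (hC.comp (by fun_prop)) (hk.comp (by fun_prop)).neg (by simp [hCpi])
      (fun t ht => hC1 _ (hm t ht)) (fun t ht => hμ _ (hm t ht))
      (fun t ht => ((hdC _ (hm t ht)).comp t (hs t)).congr_deriv (by ring))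
    simp only [sub_zero] at this
    rcases (sq_eq_sq_iff_eq_or_eq_neg.1 (hkpi.trans (one_pow 2).symm)) with e | e <;> linarith

theorem ContDiffOn.exists_lipschitzOnWith_Icc {H : ℝ → ℝ} {a b : ℝ} (hab : a < b)
    (hH : ContDiffOn ℝ 1 H (Set.Icc a b)) : ∃ K, LipschitzOnWith K H (Set.Icc a b) := by
  have hc := hH.continuousOn_derivWithin (uniqueDiffOn_Icc hab) le_rfl
  obtain ⟨K, hK⟩ := isCompact_Icc.exists_bound_of_continuousOn hc
  refine ⟨K.toNNReal, (convex_Icc a b).lipschitzOnWith_of_nnnorm_derivWithin_le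
    (hH.differentiableOn one_ne_zero) fun x hx => ?_⟩
  rw [← NNReal.coe_le_coe, coe_nnnorm]
  exact (hK x hx).trans (Real.le_coe_toNNReal K)

theorem ContinuousOn.pos_or_neg_of_ne_zero {g : ℝ → ℝ} {a b : ℝ}
    (hg : ContinuousOn g (Set.Ioo a b)) (h0 : ∀ t ∈ Set.Ioo a b, g t ≠ 0) :
    (∀ t ∈ Set.Ioo a b, 0 < g t) ∨ ∀ t ∈ Set.Ioo a b, 0 < -g t := by
  by_contra! hn
  obtain ⟨⟨s, hs, hs0⟩, t, ht, ht0⟩ := hn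
  obtain ⟨r, hr, hr0⟩ := isPreconnected_Ioo.intermediate_value hs ht hg
    ⟨hs0, by linarith⟩
  exact h0 r hr hr0

theorem IsStdRotHSphere.sqrt_lt {H : ℝ → ℝ} {f η : S2 → LR} (h : IsStdRotHSphere H f η)
    (hH : ContDiffOn ℝ 1 H (Set.Icc (-1) 1)) :
    ∀ y ∈ Set.Icc (-1 : ℝ) 1, √(1 - y ^ 2) < 2 * |H y| := by
  have hf : ContDiff ℝ 2 (fun t => f (meridian t)) :=
    (h.immersed.contMDiff.comp contMDiff_meridian).contDiff
  have hη : Continuous (fun t => η (meridian t)) :=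
    (h.unitNormal.contMDiff.comp contMDiff_meridian).continuous
  have hx : ContDiff ℝ 2 (fun t => (f (meridian t)).1 2) := contDiff_pi.1 hf.fst 2
  have hz : ContDiff ℝ 2 (fun t => (f (meridian t)).2) := hf.snd
  have hdx := hx.continuous_deriv one_le_two
  have hdz := hz.continuous_deriv one_le_two
  have hW : Continuous (fun t => -(η (meridian t)).1 2) :=
    ((continuous_apply 2).comp hη.fst).neg
  have hk : Continuous (fun t => (η (meridian t)).2) := hη.snd
  have hm : ∀ t ∈ Set.Ioo 0 Real.pi, Real.sin t ≠ 0 := fun t ht =>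
    (Real.sin_pos_of_mem_Ioo ht).ne'
  obtain ⟨p0, -, p1⟩ := h.pole Real.sin_zero
  obtain ⟨q0, -, q1⟩ := h.pole Real.sin_pi
  have hμc : ContinuousOn (speedRatio f η) (Set.Ioo 0 Real.pi) := by
    refine ContinuousOn.div ((hdx.mul hk).add (hdz.mul hW)).continuousOn
      ((hx.continuous.pow 2).sub continuous_const).continuousOn fun t ht => ?_
    have := (h.profile_at (hm t ht)).1
    nlinarith
  obtain ⟨K, hK⟩ := hH.exists_lipschitzOnWith_Icc (by norm_num)
  have hsq : ∀ t ∈ Set.Icc 0 Real.pi, (-(η (meridian t)).1 2) ^ 2 =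
      ((f (meridian t)).1 2 ^ 2 - 1) * (1 - (η (meridian t)).2 ^ 2) := fun t _ => by
    rw [neg_sq]; exact h.η_two_sq _
  rcases hμc.pos_or_neg_of_ne_zero fun t ht => (h.profile_at (hm t ht)).2.2.1 with hμ | hμ
  · exact (IsProfile.of_sq_eq_one hx.continuous hW hk p0 q0
      (fun t ht => (h.profile_at (hm t ht)).1) hsq p1 q1 hμ
      (fun t ht => (h.profile_at (hm t ht)).2.2.2.1)
      (fun t ht => (h.profile_at (hm t ht)).2.2.2.2.1)
      (fun t ht => (h.profile_at (hm t ht)).2.2.2.2.2)).sqrt_lt hK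
  · -- The opposite unit normal `-η` has `μ > 0`, and turns `H` into `y ↦ -H (-y)`.
    have hK' : LipschitzOnWith K (fun y => -H (-y)) (Set.Icc (-1) 1) := by
      refine LipschitzOnWith.of_dist_le_mul fun y hy z hz => ?_
      rw [dist_neg_neg, ← dist_neg_neg y z]
      exact hK.dist_le_mul _ ⟨by linarith [hy.2], by linarith [hy.1]⟩ _
        ⟨by linarith [hz.2], by linarith [hz.1]⟩
    have hp : IsProfile (fun y => -H (-y)) (fun t => (f (meridian t)).1 2)
        (fun t => - -(η (meridian t)).1 2) (fun t => -(η (meridian t)).2)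
        (fun t => -speedRatio f η t) :=
      IsProfile.of_sq_eq_one hx.continuous hW.neg hk.neg p0 q0
        (fun t ht => (h.profile_at (hm t ht)).1)
        (fun t ht => by rw [neg_sq, hsq t ht, neg_sq]) (by simpa using p1) (by simpa using q1) hμ
        (fun t ht => (h.profile_at (hm t ht)).2.2.2.1.congr_deriv (by ring))
        (fun t ht => (h.profile_at (hm t ht)).2.2.2.2.1.fun_neg.congr_deriv (by
          rw [neg_neg (η (meridian t)).2]; ring))
        (fun t ht => (h.profile_at (hm t ht)).2.2.2.2.2.fun_neg.congr_deriv (by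
          rw [neg_neg (η (meridian t)).2]; ring))
    intro y hy
    have := hp.sqrt_lt hK' (-y) ⟨by linarith [hy.2], by linarith [hy.1]⟩
    simpa using this
end

theorem proposition3p6 (H : ℝ → ℝ) (hH : ContDiffOn ℝ 1 H (Set.Icc (-1) 1))
    (hS : ∃ f η : S2 → LR, IsHSphere H f η ∧ IsRotational f) :
    (∀ y ∈ Set.Icc (-1 : ℝ) 1, Real.sqrt (1 - y ^ 2) < 2 * |H y|) ∧
      ∀ y ∈ Set.Icc (-1 : ℝ) 1, H y ≠ 0 := by
  obtain ⟨f, η, hfη, hrot⟩ := hS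
  obtain ⟨f', η', h⟩ := hfη.exists_isStdRotHSphere hrot
  refine ⟨h.sqrt_lt hH, fun y hy h0 => ?_⟩
  have := h.sqrt_lt hH y hy
  rw [h0, abs_zero, mul_zero] at this
  exact absurd this (not_lt.2 (Real.sqrt_nonneg _))
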